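/- **Theorem 9 (running time of parsing with derivatives).** A *grammar* over a set $\Sigma$ of tokens and a set $T$ of abstract syntax trees (with a map $\Sigma\to T$ regarding tokens as trees) is a finite, possibly cyclic, directed graph with a distinguished root, each node of which has one of the forms $$\emptyset,\qquad \epsilon_s,\qquad c,\qquad L_1\circ L_2,\qquad L_1\cup L_2,\qquad L\rightarrow f$$ ($s\in T$, $c\in\Sigma$, $f:T\to T$), where the children $L,L_1,L_2$ are pointers to nodes. Consider the following four functions. * `nullable?`$(L)$ computes the least solution of $\delta(\emptyset)=\delta(c)=\text{false}$, $\delta(\epsilon_s)=\text{true}$, $\delta(L_1\cup L_2)=\delta(L_1)\vee\delta(L_2)$, $\delta(L_1\circ L_2)=\delta(L_1)\wedge\delta(L_2)$, $\delta(L\rightarrow f)=\delta(L)$ over the nodes reachable from $L$. It visits the nodes not visited by an earlier call, records for each node which nodes depend on it, and reconsiders the dependents of a node only when that node is newly found to be nullable; values found by earlier calls are kept. * `derive`$(L,c)$, memoized on the pair $(L,c)$, builds the derivative by $D_c(\emptyset)=D_c(\epsilon_s)=\emptyset$; $D_c(c')=\epsilon_c$ if $c=c'$ and $\emptyset$ otherwise;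 $D_c(L_1\cup L_2)=D_c(L_1)\cup D_c(L_2)$; $D_c(L\rightarrow f)=D_c(L)\rightarrow f$; $D_c(L_1\circ L_2)=D_c(L_1)\circ L_2$ if $L_1$ is not nullable, and $(D_c(L_1)\circ L_2)\cup D_c(L_2)$ if it is. A new node with its children still missing is entered in the memoization table before the recursive calls and completed after them. * `parse-null`$(L)$, memoized on $L$, builds in the same manner a parse forest, that is, a possibly cyclic graph: no tree for $\emptyset$ and $c$, the tree $s$ for $\epsilon_s$, an ambiguity node for $L_1\cup L_2$, a pair node for $L_1\circ L_2$, and a node applying $f$ for $L\rightarrow f$. * `parse` applies `derive` to the root by the successive input tokens, and then `parse-null` to the resulting node. The running time is the number of unit-cost operations, these being: calling a function, reading, creating or updating a grammar or forest node, reading or updating an entry of a memoization, nullability or dependency table, and comparing two tokens. There is a constant $C$ such that for every $\Sigma$ and $T$, every grammar with $G$ nodes and every input of length $n$, `parse` terminates without error after at most $C\,G\,\max(n,1)^3$ operations. In particular its running time is $O(Gn^3)$ for $n\ge 1$ (and $O(G)$ for $n=0$). -/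

import Mathlib

namespace PWD

/-! ### Grammars -/

/-- Parsing expression forms over tokens `α` and abstract syntax trees `T`; the children of a
form are pointers of type `P`, so that grammars may be cyclic graphs. -/
inductive Form (α T P : Type) : Type where
  | empty : Form α T P
  | eps (s : T) : Form α T P
  | token (c : α) : Form α T P
  | seq (l r : P) : Form α T P
  | alt (l r : P) : Form α T P
  | red (l : P) (f : T → T) : Form α T P

/-- Apply a function to the child pointers of a form. -/
def Form.map {α T P Q : Type} (h : P → Q) : Form α T P → Form α T Q
  | .empty => .empty
  | .eps s => .eps s
  | .token c => .token c
  | .seq l r => .seq (h l) (h r)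
  | .alt l r => .alt (h l) (h r)
  | .red l f => .red (h l) f

/-- A form whose children may still be unknown, as a form with known children. -/
def Form.complete? {α T P : Type} : Form α T (Option P) → Option (Form α T P)
  | .empty => some .empty
  | .eps s => some (.eps s)
  | .token c => some (.token c)
  | .seq (some l) (some r) => some (.seq l r)
  | .alt (some l) (some r) => some (.alt l r)
  | .red (some l) f => some (.red l f)
  | _ => none

/-- A context-free grammar as a finite, possibly cyclic, graph of parsing expression nodes.
`size` is the number of its nodes. -/
structure Grammar (α T : Type) where
  size : ℕ
  node : Fin size → Form α T (Fin size)
  root : Fin size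

/-! ### The store and its unit-cost operations -/

/-- Addresses of grammar nodes and of parse-forest nodes. -/
abbrev Ptr := ℕ

/-- Nodes of a parse forest, a possibly cyclic graph: no parse, a single tree, all pairs of a tree
of `l` and a tree of `r`, the ambiguity node that has the trees of `l` and those of `r`, and the
images under `f` of the trees of `l`. -/
inductive ForestNode (T P : Type) : Type where
  | empty : ForestNode T P
  | leaf (s : T) : ForestNode T P
  | pair (l r : P) : ForestNode T P
  | amb (l r : P) : ForestNode T P
  | apply (f : T → T) (l : P) : ForestNode T P

/-- The memory of the parser. A child pointer `none` is one that is not known yet, in a node that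
is still under construction. -/
structure Store (α T : Type) where
  /-- the number of unit-cost operations performed so far -/
  time : ℕ
  /-- the grammar nodes at addresses `0, …, nodeCount - 1` -/
  nodeCount : ℕ
  nodes : Ptr → Option (Form α T (Option Ptr))
  /-- memoization table of `derive` -/
  deriveMemo : Ptr → α → Option Ptr
  /-- the nodes that a nullability fixed point has reached -/
  visited : Ptr → Bool
  /-- the nodes known to be nullable -/
  isNull : Ptr → Bool
  /-- the nodes to reconsider when the given node is discovered to be nullable -/
  dependents : Ptr → List Ptr
  /-- the forest nodes at addresses `0, …, forestCount - 1` -/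
  forestCount : ℕ
  forest : Ptr → Option (ForestNode T (Option Ptr))
  /-- memoization table of `parseNull` -/
  forestMemo : Ptr → Option Ptr

/-- The initial memory: it holds the nodes of the grammar, and all tables are empty. -/
def Grammar.initialStore {α T : Type} (g : Grammar α T) : Store α T where
  time := 0
  nodeCount := g.size
  nodes := fun p => if h : p < g.size then some ((g.node ⟨p, h⟩).map fun i => some i.val) else none
  deriveMemo := fun _ _ => none
  visited := fun _ => false
  isNull := fun _ => false
  dependents := fun _ => []
  forestCount := 0
  forest := fun _ => none
  forestMemo := fun _ => none

/-- Computations on the store; `none` is a crash, or an overflow of the call stack. -/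
abbrev M (α T : Type) := StateT (Store α T) Option

section Primitives

variable {α T : Type}

/-- Charge one unit of time. Every operation below, and every function call, is charged one. -/
def tick : M α T Unit := modify fun s => { s with time := s.time + 1 }

/-- Read a grammar node. Inspecting a node with unknown children is a crash. -/
def readNode (p : Ptr) : M α T (Form α T Ptr) := do
  tick
  match ((← get).nodes p).bind Form.complete? with
  | some a => pure a
  | none => failure

/-- Create a new grammar node. -/
def newNode (a : Form α T (Option Ptr)) : M α T Ptr := do
  tick
  let s ← get
  set { s with
    nodeCount := s.nodeCount + 1
    nodes := Function.update s.nodes s.nodeCount (some a) }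
  pure s.nodeCount

/-- Overwrite a grammar node, to fill in its children. -/
def writeNode (p : Ptr) (a : Form α T (Option Ptr)) : M α T Unit := do
  tick
  modify fun s => { s with nodes := Function.update s.nodes p (some a) }

/-- Compare two tokens. -/
def sameToken [DecidableEq α] (c c' : α) : M α T Bool := do
  tick
  pure (decide (c = c'))

def getDerive (p : Ptr) (c : α) : M α T (Option Ptr) := do
  tick
  pure ((← get).deriveMemo p c)

def setDerive [DecidableEq α] (p : Ptr) (c : α) (q : Ptr) : M α T Unit := do
  tick
  modify fun s => { s with
    deriveMemo := Function.update s.deriveMemo p (Function.update (s.deriveMemo p) c (some q)) }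

def getVisited (p : Ptr) : M α T Bool := do
  tick
  pure ((← get).visited p)

def setVisited (p : Ptr) : M α T Unit := do
  tick
  modify fun s => { s with visited := Function.update s.visited p true }

def getNull (p : Ptr) : M α T Bool := do
  tick
  pure ((← get).isNull p)

def setNull (p : Ptr) : M α T Unit := do
  tick
  modify fun s => { s with isNull := Function.update s.isNull p true }

/-- The head of the linked list of the nodes that depend on `p`. -/
def getDependents (p : Ptr) : M α T (List Ptr) := do
  tick
  pure ((← get).dependents p)

/-- Record that the nullability of `d` depends on that of `p`. -/
def addDependent (p d : Ptr) : M α T Unit := do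
  tick
  modify fun s => { s with dependents := Function.update s.dependents p (d :: s.dependents p) }

/-- Create a new forest node. -/
def newForest (a : ForestNode T (Option Ptr)) : M α T Ptr := do
  tick
  let s ← get
  set { s with
    forestCount := s.forestCount + 1
    forest := Function.update s.forest s.forestCount (some a) }
  pure s.forestCount

/-- Overwrite a forest node, to fill in its children. -/
def writeForest (p : Ptr) (a : ForestNode T (Option Ptr)) : M α T Unit := do
  tick
  modify fun s => { s with forest := Function.update s.forest p (some a) }

def getForest (p : Ptr) : M α T (Option Ptr) := do
  tick
  pure ((← get).forestMemo p)

def setForest (p q : Ptr) : M α T Unit := do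
  tick
  modify fun s => { s with forestMemo := Function.update s.forestMemo p (some q) }

end Primitives

/-! ### Nullability

In the recursive functions below the number `k` bounds the depth of nested calls. It only serves
to make them total: a computation that would nest deeper fails, and otherwise `k` has no effect. -/

section Parsing

variable {α T : Type}

/-- The equation for the nullability of node `p`, evaluated at the current values of its
children. -/
def evalNull (p : Ptr) : M α T Bool := do
  tick
  match ← readNode p with
  | .empty => pure false
  | .eps _ => pure true
  | .token _ => pure false
  | .alt l r =>
    let a ← getNull l
    let b ← getNull r
    pure (a || b)
  | .seq l r =>
    let a ← getNull l
    let b ← getNull r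
    pure (a && b)
  | .red l _ => getNull l

/-- Reconsider the nodes of a list; when one of them is newly discovered to be nullable,
reconsider the nodes that depend on it. -/
def reconsider : ℕ → List Ptr → M α T Unit
  | 0, _ => failure
  | k + 1, ds => do
    tick
    match ds with
    | [] => pure ()
    | d :: ds =>
      let known ← getNull d
      if known then
        reconsider k ds
      else
        let now ← evalNull d
        if now then
          setNull d
          let deps ← getDependents d
          reconsider k deps
          reconsider k ds
        else
          reconsider k ds

/-- Extend the nullability fixed point to all nodes reachable from `p` that have not been visited
yet. -/
def visit : ℕ → Ptr → M α T Unit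
  | 0, _ => failure
  | k + 1, p => do
    tick
    let seen ← getVisited p
    if seen then
      pure ()
    else
      setVisited p
      match ← readNode p with
      | .empty => pure ()
      | .eps _ => pure ()
      | .token _ => pure ()
      | .alt l r =>
        addDependent l p
        visit k l
        addDependent r p
        visit k r
      | .seq l r =>
        addDependent l p
        visit k l
        addDependent r p
        visit k r
      | .red l _ =>
        addDependent l p
        visit k l
      reconsider k [p]

/-- `nullable?`: nodes visited by an earlier call have their final value; otherwise a new fixed
point is computed over the unvisited nodes reachable from `p`. -/
def nullable (k : ℕ) (p : Ptr) : M α T Bool := do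
  tick
  visit k p
  getNull p

/-! ### Derivatives -/

/-- The memoized derivative of node `p` by the token `c`. A node that is missing its children is
put into the memoization table before the recursive calls and is completed after them. The map
`tok` regards tokens as abstract syntax trees. -/
def derive [DecidableEq α] (tok : α → T) : ℕ → Ptr → α → M α T Ptr
  | 0, _, _ => failure
  | k + 1, p, c => do
    tick
    match ← getDerive p c with
    | some q => pure q
    | none =>
      match ← readNode p with
      | .empty =>
        let q ← newNode .empty
        setDerive p c q
        pure q
      | .eps _ =>
        let q ← newNode .empty
        setDerive p c q
        pure q
      | .token c' =>
        let same ← sameToken c c'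
        let q ← newNode (if same then .eps (tok c) else .empty)
        setDerive p c q
        pure q
      | .alt l r =>
        let q ← newNode (.alt none none)
        setDerive p c q
        let l' ← derive tok k l c
        let r' ← derive tok k r c
        writeNode q (.alt (some l') (some r'))
        pure q
      | .seq l r =>
        let null ← nullable k l
        if null then
          let q ← newNode (.alt none none)
          setDerive p c q
          let q' ← newNode (.seq none (some r))
          let l' ← derive tok k l c
          writeNode q' (.seq (some l') (some r))
          let r' ← derive tok k r c
          writeNode q (.alt (some q') (some r'))
          pure q
        else
          let q ← newNode (.seq none (some r))
          setDerive p c q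
          let l' ← derive tok k l c
          writeNode q (.seq (some l') (some r))
          pure q
      | .red l f =>
        let q ← newNode (.red none f)
        setDerive p c q
        let l' ← derive tok k l c
        writeNode q (.red (some l') f)
        pure q

/-! ### Extraction of the parse forest, and the outer loop -/

/-- `parse-null`: a forest node for the trees with which node `p` accepts the empty word. -/
def parseNull : ℕ → Ptr → M α T Ptr
  | 0, _ => failure
  | k + 1, p => do
    tick
    match ← getForest p with
    | some q => pure q
    | none =>
      match ← readNode p with
      | .empty =>
        let q ← newForest .empty
        setForest p q
        pure q
      | .eps s =>
        let q ← newForest (.leaf s)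
        setForest p q
        pure q
      | .token _ =>
        let q ← newForest .empty
        setForest p q
        pure q
      | .alt l r =>
        let q ← newForest (.amb none none)
        setForest p q
        let l' ← parseNull k l
        let r' ← parseNull k r
        writeForest q (.amb (some l') (some r'))
        pure q
      | .seq l r =>
        let q ← newForest (.pair none none)
        setForest p q
        let l' ← parseNull k l
        let r' ← parseNull k r
        writeForest q (.pair (some l') (some r'))
        pure q
      | .red l f =>
        let q ← newForest (.apply f none)
        setForest p q
        let l' ← parseNull k l
        writeForest q (.apply f (some l'))
        pure q

/-- Parse from the node `p`: derive by each input token in turn, then extract the forest. -/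
def parseFrom [DecidableEq α] (tok : α → T) (k : ℕ) (p : Ptr) : List α → M α T Ptr
  | [] => do
    tick
    parseNull k p
  | c :: w => do
    tick
    let p' ← derive tok k p c
    parseFrom tok k p' w

/-- `parse`, started on the initial memory, with room for `k` nested calls. If this is enough for
a normal termination, the outcome is the root of the parse forest and the final memory, which
holds the forest and the running time; the outcome does not depend on `k` then. -/
def parse [DecidableEq α] (tok : α → T) (k : ℕ) (g : Grammar α T) (w : List α) :
    Option (Ptr × Store α T) :=
  (parseFrom tok k g.root.val w).run g.initialStore

end Parsing

end PWD

/-! The heart of the matter is a count of the grammar nodes ever created. Every node gets a name: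
the node of the original grammar from which it descends, and the word by which that node was
derived, cut in two where an alternative was split off a nullable sequence. Derivation appends the
token to one of the two pieces, so a name determines the node and the token from which it arose
(`Name.IsDeriv.unique`). Memoization derives each pair of node and token only once, so distinct
nodes have distinct names (`Named`).

After a prefix `u` of the input the current root is named by a suffix of `u`. Children are named by
suffixes of their parent's word, since the right operand of a sequence is always an underived node
of the grammar (`GoodNode`). Hence all words are factors of the input. A factor with a cut is given
by a start and two lengths, so there are at most `G * (n + 1) ^ 3` nodes (`Named.nodeCount_le`).

The remaining work is constant per node, by amortization. All nullability fixed points share their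
tables: a node is explored once, and its recorded dependents are reconsidered only when it becomes
nullable, so their total work is linear in the number of nodes (`wp_reconsider`, `wp_visit`). A
derivation spends at most 60 operations per created node, which includes prepayment of that node's
future nullability work (`wp_derive`); the forest costs 10 per node (`wp_parseNull`). `wp_parseFrom`
adds this up.

Absence of errors has two sides. The depth of nested calls is bounded by measures like those for the
time. And while one token is processed, pointers are followed only among the nodes below `m` that
existed before it; these are complete, so a node under construction is never read. -/

namespace PWD

/-! ### Total-correctness calculus for the store operations -/

section Wp

variable {α T β γ : Type}

/-- The computation `x`, started in the store `s`, terminates normally with a result and a store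
that satisfy `Q`. -/
def Wp (x : M α T β) (s : Store α T) (Q : β → Store α T → Prop) : Prop :=
  ∃ a s', x.run s = some (a, s') ∧ Q a s'

theorem wp_bind (x : M α T β) (f : β → M α T γ) (s : Store α T) (Q : γ → Store α T → Prop) :
    Wp (x >>= f) s Q ↔ Wp x s fun a s' => Wp (f a) s' Q := by
  unfold Wp
  rw [StateT.run_bind]
  rcases h : x.run s with _ | ⟨a, s'⟩ <;> simp [Option.bind_eq_bind]

theorem wp_pure (a : β) (s : Store α T) (Q : β → Store α T → Prop) :
    Wp (pure a) s Q ↔ Q a s := by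
  simp [Wp, StateT.run_pure, and_comm]

theorem Wp.mono {x : M α T β} {s : Store α T} {Q R : β → Store α T → Prop} (h : Wp x s Q)
    (hQR : ∀ a s', Q a s' → R a s') : Wp x s R := by
  obtain ⟨a, s', h₁, h₂⟩ := h
  exact ⟨a, s', h₁, hQR a s' h₂⟩

theorem wp_tick (s : Store α T) (Q : Unit → Store α T → Prop) :
    Wp tick s Q ↔ Q () { s with time := s.time + 1 } := by
  simp [Wp, tick, and_comm, Unique.exists_iff]

theorem wp_get (s : Store α T) (Q : Store α T → Store α T → Prop) :
    Wp get s Q ↔ Q s s := by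
  simp [Wp, and_comm]

theorem wp_set (s s' : Store α T) (Q : Unit → Store α T → Prop) :
    Wp (set s') s Q ↔ Q () s' := by
  simp [Wp, and_comm, StateT.run_set, Unique.exists_iff]

theorem wp_modify (f : Store α T → Store α T) (s : Store α T) (Q : Unit → Store α T → Prop) :
    Wp (modify f) s Q ↔ Q () (f s) := by
  simp [Wp, and_comm, Unique.exists_iff]

theorem wp_readNode {p : Ptr} {s : Store α T} {a : Form α T Ptr}
    (h : (s.nodes p).bind Form.complete? = some a) (Q : Form α T Ptr → Store α T → Prop) :
    Wp (readNode p) s Q ↔ Q a { s with time := s.time + 1 } := by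
  simp only [readNode, wp_bind, wp_tick, wp_get, h, wp_pure]

theorem wp_newNode (a : Form α T (Option Ptr)) (s : Store α T) (Q : Ptr → Store α T → Prop) :
    Wp (newNode a) s Q ↔ Q s.nodeCount
      { s with
        time := s.time + 1
        nodeCount := s.nodeCount + 1
        nodes := Function.update s.nodes s.nodeCount (some a) } := by
  simp only [newNode, wp_bind, wp_tick, wp_get, wp_set, wp_pure]

theorem wp_writeNode (p : Ptr) (a : Form α T (Option Ptr)) (s : Store α T)
    (Q : Unit → Store α T → Prop) :
    Wp (writeNode p a) s Q ↔ Q ()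
      { s with
        time := s.time + 1
        nodes := Function.update s.nodes p (some a) } := by
  simp only [writeNode, wp_bind, wp_tick, wp_modify]

theorem wp_sameToken [DecidableEq α] (c c' : α) (s : Store α T) (Q : Bool → Store α T → Prop) :
    Wp (sameToken c c') s Q ↔ Q (decide (c = c')) { s with time := s.time + 1 } := by
  simp only [sameToken, wp_bind, wp_tick, wp_pure]

theorem wp_getDerive (p : Ptr) (c : α) (s : Store α T) (Q : Option Ptr → Store α T → Prop) :
    Wp (getDerive p c) s Q ↔ Q (s.deriveMemo p c) { s with time := s.time + 1 } := by
  simp only [getDerive, wp_bind, wp_tick, wp_get, wp_pure]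

theorem wp_setDerive [DecidableEq α] (p : Ptr) (c : α) (q : Ptr) (s : Store α T)
    (Q : Unit → Store α T → Prop) :
    Wp (setDerive p c q) s Q ↔ Q ()
      { s with
        time := s.time + 1
        deriveMemo :=
          Function.update s.deriveMemo p (Function.update (s.deriveMemo p) c (some q)) } := by
  simp only [setDerive, wp_bind, wp_tick, wp_modify]

theorem wp_getVisited (p : Ptr) (s : Store α T) (Q : Bool → Store α T → Prop) :
    Wp (getVisited p) s Q ↔ Q (s.visited p) { s with time := s.time + 1 } := by
  simp only [getVisited, wp_bind, wp_tick, wp_get, wp_pure]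

theorem wp_setVisited (p : Ptr) (s : Store α T) (Q : Unit → Store α T → Prop) :
    Wp (setVisited p) s Q ↔ Q ()
      { s with
        time := s.time + 1
        visited := Function.update s.visited p true } := by
  simp only [setVisited, wp_bind, wp_tick, wp_modify]

theorem wp_getNull (p : Ptr) (s : Store α T) (Q : Bool → Store α T → Prop) :
    Wp (getNull p) s Q ↔ Q (s.isNull p) { s with time := s.time + 1 } := by
  simp only [getNull, wp_bind, wp_tick, wp_get, wp_pure]

theorem wp_setNull (p : Ptr) (s : Store α T) (Q : Unit → Store α T → Prop) :
    Wp (setNull p) s Q ↔ Q ()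
      { s with
        time := s.time + 1
        isNull := Function.update s.isNull p true } := by
  simp only [setNull, wp_bind, wp_tick, wp_modify]

theorem wp_getDependents (p : Ptr) (s : Store α T) (Q : List Ptr → Store α T → Prop) :
    Wp (getDependents p) s Q ↔ Q (s.dependents p) { s with time := s.time + 1 } := by
  simp only [getDependents, wp_bind, wp_tick, wp_get, wp_pure]

theorem wp_addDependent (p d : Ptr) (s : Store α T) (Q : Unit → Store α T → Prop) :
    Wp (addDependent p d) s Q ↔ Q ()
      { s with
        time := s.time + 1
        dependents := Function.update s.dependents p (d :: s.dependents p) } := by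
  simp only [addDependent, wp_bind, wp_tick, wp_modify]

theorem wp_newForest (a : ForestNode T (Option Ptr)) (s : Store α T)
    (Q : Ptr → Store α T → Prop) :
    Wp (newForest a) s Q ↔ Q s.forestCount
      { s with
        time := s.time + 1
        forestCount := s.forestCount + 1
        forest := Function.update s.forest s.forestCount (some a) } := by
  simp only [newForest, wp_bind, wp_tick, wp_get, wp_set, wp_pure]

theorem wp_writeForest (p : Ptr) (a : ForestNode T (Option Ptr)) (s : Store α T)
    (Q : Unit → Store α T → Prop) :
    Wp (writeForest p a) s Q ↔ Q ()
      { s with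
        time := s.time + 1
        forest := Function.update s.forest p (some a) } := by
  simp only [writeForest, wp_bind, wp_tick, wp_modify]

theorem wp_getForest (p : Ptr) (s : Store α T) (Q : Option Ptr → Store α T → Prop) :
    Wp (getForest p) s Q ↔ Q (s.forestMemo p) { s with time := s.time + 1 } := by
  simp only [getForest, wp_bind, wp_tick, wp_get, wp_pure]

theorem wp_setForest (p q : Ptr) (s : Store α T) (Q : Unit → Store α T → Prop) :
    Wp (setForest p q) s Q ↔ Q ()
      { s with
        time := s.time + 1
        forestMemo := Function.update s.forestMemo p (some q) } := by
  simp only [setForest, wp_bind, wp_tick, wp_modify]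

end Wp

/-! ### Counting over tables -/

/-- The effect of a single table update on a counting sum, written additively to avoid truncated
subtraction. -/
theorem sum_range_add_eq_of_eq_off {n p : ℕ} {f g : ℕ → ℕ} (hp : p < n)
    (h : ∀ i, i ≠ p → f i = g i) :
    ∑ i ∈ Finset.range n, f i + g p = ∑ i ∈ Finset.range n, g i + f p := by
  have hp' := Finset.mem_range.2 hp
  rw [← Finset.add_sum_erase _ f hp', ← Finset.add_sum_erase _ g hp',
    Finset.sum_congr rfl fun i hi => h i (Finset.ne_of_mem_erase hi)]
  ring

/-! ### Credit stored in the nullability tables, and the cost of reconsidering nodes -/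

section Weights

variable {α T : Type}

/-- The number of nodes not yet known to be nullable, and of their recorded dependents. -/
def pendingWeight (s : Store α T) : ℕ :=
  ∑ p ∈ Finset.range s.nodeCount, if s.isNull p then 0 else (s.dependents p).length + 1

/-- The number of nodes that no nullability fixed point has reached. -/
def unvisitedCount (s : Store α T) : ℕ :=
  ∑ p ∈ Finset.range s.nodeCount, if s.visited p then 0 else 1

/-- The number of nodes below `m` whose derivative by `c` is not memoized. -/
def underivedCount (m : ℕ) (c : α) (s : Store α T) : ℕ :=
  ∑ p ∈ Finset.range m, if (s.deriveMemo p c).isSome then 0 else 1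

/-- The number of nodes without a memoized parse forest. -/
def unparsedCount (s : Store α T) : ℕ :=
  ∑ p ∈ Finset.range s.nodeCount, if (s.forestMemo p).isSome then 0 else 1

/-- The child pointers of a form. -/
def Form.children {P : Type} : Form α T P → List P
  | .empty => []
  | .eps _ => []
  | .token _ => []
  | .seq l r => [l, r]
  | .alt l r => [l, r]
  | .red l _ => [l]

/-- All nodes below `m` are complete, and their children are below `m`. -/
def ClosedBelow (m : ℕ) (nodes : ℕ → Option (Form α T (Option ℕ))) : Prop :=
  ∀ p < m, ∃ a, (nodes p).bind Form.complete? = some a ∧ ∀ l ∈ a.children, l < m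

/-- Dependencies are recorded only between nodes below `m`. -/
def DependentsBelow (m : ℕ) (s : Store α T) : Prop :=
  ∀ p, ∀ d ∈ s.dependents p, p < m ∧ d < m

/-- The two stores differ at most in the time and in the nullability tables. -/
structure SameGraph (s s' : Store α T) : Prop where
  nodeCount : s'.nodeCount = s.nodeCount
  nodes : s'.nodes = s.nodes
  deriveMemo : s'.deriveMemo = s.deriveMemo

theorem SameGraph.refl (s : Store α T) : SameGraph s s := ⟨rfl, rfl, rfl⟩

theorem SameGraph.trans {s s' s'' : Store α T} (h : SameGraph s s') (h' : SameGraph s' s'') :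
    SameGraph s s'' :=
  ⟨h'.1.trans h.1, h'.2.trans h.2, h'.3.trans h.3⟩

/-- The postcondition is demanded for both truth values: the cost analysis never needs to know which
nodes are nullable. -/
theorem wp_evalNull {m : ℕ} {s : Store α T} {p : ℕ} (hc : ClosedBelow m s.nodes) (hp : p < m)
    {Q : Bool → Store α T → Prop}
    (hQ : ∀ b t, t ≤ s.time + 4 → Q b { s with time := t }) : Wp (evalNull p) s Q := by
  obtain ⟨a, ha, -⟩ := hc p hp
  simp only [evalNull, wp_bind, wp_tick]
  rw [wp_readNode (a := a) (by exact ha)]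
  cases a <;> simp only [wp_pure, wp_bind, wp_getNull] <;> exact hQ _ _ (by omega)

/-- A node that becomes nullable releases one unit of credit per dependent, which pays for
reconsidering them, and one for itself, which covers the call on the end of that list. -/
theorem pendingWeight_setNull {s s' : Store α T} {d : ℕ} (hd : d < s.nodeCount)
    (hn : s.isNull d = false) (h1 : s'.nodeCount = s.nodeCount)
    (h2 : s'.isNull = Function.update s.isNull d true) (h3 : s'.dependents = s.dependents) :
    pendingWeight s' + (s.dependents d).length + 1 = pendingWeight s := by
  have := sum_range_add_eq_of_eq_off hd
    (f := fun p => if s'.isNull p then 0 else (s'.dependents p).length + 1)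
    (g := fun p => if s.isNull p then 0 else (s.dependents p).length + 1)
    (fun i hi => by simp [h2, h3, hi])
  simp only [h2, h3, hn, Function.update_self] at this
  simp only [pendingWeight, h1, h2, h3]
  simpa [add_assoc] using this

theorem pendingWeight_addDependent {s s' : Store α T} {p d : ℕ}
    (hp : p < s.nodeCount) (h1 : s'.nodeCount = s.nodeCount) (h2 : s'.isNull = s.isNull)
    (h3 : s'.dependents = Function.update s.dependents p (d :: s.dependents p)) :
    pendingWeight s' ≤ pendingWeight s + 1 := by
  have := sum_range_add_eq_of_eq_off hp
    (f := fun p => if s'.isNull p then 0 else (s'.dependents p).length + 1)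
    (g := fun p => if s.isNull p then 0 else (s.dependents p).length + 1)
    (fun i hi => by simp [h2, h3, hi])
  simp only [pendingWeight, h1] at this ⊢
  simp only [h2, h3, Function.update_self, List.length_cons] at this ⊢
  split at this <;> omega

theorem unvisitedCount_setVisited {s s' : Store α T} {p : ℕ} (hp : p < s.nodeCount)
    (hn : s.visited p = false) (h1 : s'.nodeCount = s.nodeCount)
    (h2 : s'.visited = Function.update s.visited p true) :
    unvisitedCount s' + 1 = unvisitedCount s := by
  have := sum_range_add_eq_of_eq_off hp
    (f := fun p => if s'.visited p then 0 else 1) (g := fun p => if s.visited p then 0 else 1)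
    (fun i hi => by simp [h2, hi])
  simp only [unvisitedCount, h1]
  simpa [h2, hn] using this

/-- Reconsidering a list, at an amortized cost of eight operations for each entry. -/
theorem wp_reconsider {m : ℕ} (k : ℕ) (ds : List ℕ) (s : Store α T)
    (hc : ClosedBelow m s.nodes) (hm : m ≤ s.nodeCount) (hdep : DependentsBelow m s)
    (hds : ∀ d ∈ ds, d < m) (hk : ds.length + pendingWeight s < k) :
    Wp (reconsider k ds) s fun _ s' =>
      SameGraph s s' ∧ s'.visited = s.visited ∧ s'.dependents = s.dependents ∧
        pendingWeight s' ≤ pendingWeight s ∧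
        s'.time + 8 * pendingWeight s' ≤ s.time + 8 * (pendingWeight s + ds.length) + 1 := by
  induction k generalizing ds s with
  | zero => omega
  | succ k ih =>
    rcases ds with _ | ⟨d, ds⟩
    · simp only [reconsider, wp_bind, wp_tick, wp_pure]
      refine ⟨⟨rfl, rfl, rfl⟩, trivial, trivial, le_rfl, ?_⟩
      simp only [pendingWeight, List.length_nil]
      omega
    · have hd : d < m := hds d (by simp)
      have hds' : ∀ d ∈ ds, d < m := fun e he => hds e (by simp [he])
      simp only [List.length_cons] at hk ⊢
      simp only [reconsider, wp_bind, wp_tick, wp_getNull]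
      split
      · refine (ih ds _ (by exact hc) (by exact hm) (by exact hdep) hds'
          (by simp only [pendingWeight] at hk ⊢; omega)).mono ?_
        rintro _ s' ⟨⟨h1, h2, h3⟩, h4, h5, h6, h7⟩
        refine ⟨⟨h1, h2, h3⟩, h4, h5, h6, ?_⟩
        simp only [pendingWeight] at h7 ⊢; omega
      · rename_i hn
        rw [wp_bind]
        refine wp_evalNull (by exact hc) hd ?_
        intro b t ht
        simp only at ht
        split
        -- The costliest entry: two operations for the call and the lookup, at most four for the
        -- equation, two here. This is the eight of the amortized bound.
        · simp only [wp_bind, wp_setNull, wp_getDependents]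
          set s₁ : Store α T := { s with
            time := t + 1 + 1
            isNull := Function.update s.isNull d true } with hs₁
          have hw : pendingWeight s₁ + (s.dependents d).length + 1 = pendingWeight s :=
            pendingWeight_setNull (by omega) (by simpa using hn) rfl rfl rfl
          refine (ih (s.dependents d) s₁ hc hm hdep (fun e he => (hdep d e he).2)
            (by omega)).mono ?_
          rintro _ s₂ ⟨g, h4, h5, h6, h7⟩
          refine (ih ds s₂ (by rw [g.nodes]; exact hc) (by rw [g.nodeCount]; exact hm)
            (by unfold DependentsBelow; rw [h5]; exact hdep) hds' (by omega)).mono ?_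
          rintro _ s₃ ⟨g', h4', h5', h6', h7'⟩
          have ht₁ : s₁.time = t + 1 + 1 := rfl
          exact ⟨(SameGraph.mk rfl rfl rfl : SameGraph s s₁).trans (g.trans g'), h4'.trans h4,
            h5'.trans h5, by omega, by omega⟩
        · refine (ih ds _ (by exact hc) (by exact hm) (by exact hdep) hds'
            (by simp only [pendingWeight] at hk ⊢; omega)).mono ?_
          rintro _ s' ⟨⟨h1, h2, h3⟩, h4, h5, h6, h7⟩
          refine ⟨⟨h1, h2, h3⟩, h4, h5, h6, ?_⟩
          simp only [pendingWeight] at h7 ⊢; omega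

end Weights

/-! ### Amortized cost of the nullability fixed points -/

section Fixpoint

variable {α T : Type}

theorem DependentsBelow.addDependent {m : ℕ} {s s' : Store α T} {p d : ℕ}
    (h : DependentsBelow m s) (hp : p < m) (hd : d < m)
    (h' : s'.dependents = Function.update s.dependents p (d :: s.dependents p)) :
    DependentsBelow m s' := by
  intro q e he
  rw [h'] at he
  by_cases hq : q = p
  · subst hq
    rw [Function.update_self, List.mem_cons] at he
    rcases he with rfl | he
    · exact ⟨hp, hd⟩
    · exact h q e he
  · rw [Function.update_of_ne hq] at he
    exact h q e he

/-- The measure that bounds the depth of nested calls of a nullability fixed point. -/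
def nullRank (s : Store α T) : ℕ := pendingWeight s + 3 * unvisitedCount s

/-- The operations performed so far, and those that the pending work of the nullability fixed
points has been granted. -/
def nullPotential (s : Store α T) : ℕ :=
  s.time + 8 * pendingWeight s + 33 * unvisitedCount s

/-- What a call within a nullability fixed point guarantees, if it is granted `t` operations. -/
structure NullStep (m t : ℕ) (s s' : Store α T) : Prop extends SameGraph s s' where
  dep : DependentsBelow m s'
  rank : nullRank s' ≤ nullRank s
  potential : nullPotential s' ≤ nullPotential s + t

/-- The 11 is one operation to record the dependency, eight of credit for reconsidering it later,
and two for a call on a node. -/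
theorem wp_visit_child {m k : ℕ} {p l : ℕ} {s : Store α T}
    (ih : ∀ (p : ℕ) (s : Store α T), ClosedBelow m s.nodes → m ≤ s.nodeCount →
      DependentsBelow m s → p < m → nullRank s + 1 < k →
      Wp (visit k p) s fun _ s' => NullStep m 2 s s')
    (hc : ClosedBelow m s.nodes) (hm : m ≤ s.nodeCount) (hdep : DependentsBelow m s)
    (hp : p < m) (hl : l < m) (hk : nullRank s + 2 < k) :
    Wp (addDependent l p >>= fun _ => visit k l) s fun _ s' =>
      SameGraph s s' ∧ DependentsBelow m s' ∧ nullRank s' ≤ nullRank s + 1 ∧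
      nullPotential s' ≤ nullPotential s + 11 := by
  simp only [wp_bind, wp_addDependent]
  set s₁ : Store α T := { s with
    time := s.time + 1
    dependents := Function.update s.dependents l (p :: s.dependents l) } with hs₁
  have hw : pendingWeight s₁ ≤ pendingWeight s + 1 :=
    pendingWeight_addDependent (by omega) rfl rfl rfl
  have hu : unvisitedCount s₁ = unvisitedCount s := rfl
  have ht : s₁.time = s.time + 1 := rfl
  have hr : nullRank s₁ ≤ nullRank s + 1 := by unfold nullRank; omega
  have hq : nullPotential s₁ ≤ nullPotential s + 9 := by unfold nullPotential; omega
  refine (ih l s₁ hc hm (hdep.addDependent hl hp rfl) hl (by omega)).mono ?_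
  rintro _ s₂ ⟨g, h1, h2, h3⟩
  exact ⟨(SameGraph.mk rfl rfl rfl : SameGraph s s₁).trans g, h1, by omega, by omega⟩

/-- A call on a visited node costs 2, charged to the caller. A first visit costs 4 + 2 * 11 + 9 =
35: the preamble, two children, and reconsidering the node itself. Beyond the caller's 2, this is
the 33 stored on each unvisited node. In the rank, an unvisited node weighs 3 so that it outweighs
the two dependencies its visit may record. -/
theorem wp_visit {m : ℕ} (k : ℕ) (p : ℕ) (s : Store α T) (hc : ClosedBelow m s.nodes)
    (hm : m ≤ s.nodeCount) (hdep : DependentsBelow m s) (hp : p < m)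
    (hk : nullRank s + 1 < k) :
    Wp (visit k p) s fun _ s' => NullStep m 2 s s' := by
  induction k generalizing p s with
  | zero => omega
  | succ k ih =>
    simp only [visit, wp_bind, wp_tick, wp_getVisited]
    split
    · rw [wp_pure]
      refine ⟨⟨rfl, rfl, rfl⟩, hdep, le_rfl, ?_⟩
      simp only [nullPotential, pendingWeight, unvisitedCount]
      omega
    · rename_i hv
      simp only [wp_bind, wp_setVisited]
      obtain ⟨a, ha, hch⟩ := hc p hp
      rw [wp_readNode (a := a) (by exact ha)]
      set s₁ : Store α T := { s with
        time := s.time + 1 + 1 + 1 + 1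
        visited := Function.update s.visited p true } with hs₁
      have hg : SameGraph s s₁ := ⟨rfl, rfl, rfl⟩
      have hu : unvisitedCount s₁ + 1 = unvisitedCount s :=
        unvisitedCount_setVisited (by omega) (by simpa using hv) rfl rfl
      have hw : pendingWeight s₁ = pendingWeight s := rfl
      have ht : s₁.time = s.time + 1 + 1 + 1 + 1 := rfl
      have hr : nullRank s₁ + 3 = nullRank s := by unfold nullRank; omega
      have hq : nullPotential s₁ + 29 = nullPotential s := by unfold nullPotential; omega
      have finish : ∀ s₂, SameGraph s₁ s₂ → DependentsBelow m s₂ →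
          nullRank s₂ ≤ nullRank s₁ + 2 → nullPotential s₂ ≤ nullPotential s₁ + 22 →
          Wp (reconsider k [p]) s₂ fun _ s' => NullStep m 2 s s' := by
        intro s₂ g₂ d₂ r₂ q₂
        refine (wp_reconsider k [p] s₂ (by rw [g₂.nodes]; exact hc)
          (by rw [g₂.nodeCount]; exact hm) d₂ (by simpa using hp)
          (by unfold nullRank at *; simp only [List.length_singleton]; omega)).mono ?_
        rintro _ s₃ ⟨g₃, v₃, e₃, w₃, t₃⟩
        have hu₃ : unvisitedCount s₃ = unvisitedCount s₂ := by
          unfold unvisitedCount; rw [v₃, g₃.nodeCount]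
        simp only [List.length_singleton] at t₃
        refine ⟨hg.trans (g₂.trans g₃), by unfold DependentsBelow; rw [e₃]; exact d₂, ?_, ?_⟩
        · unfold nullRank at *; omega
        · unfold nullPotential at *; omega
      have two : ∀ l r : ℕ, l < m → r < m →
          Wp (addDependent l p >>= fun _ => visit k l >>= fun _ => addDependent r p >>= fun _ =>
            visit k r >>= fun _ => reconsider k [p]) s₁ fun _ s' => NullStep m 2 s s' := by
        intro l r hl hr'
        rw [← bind_assoc, wp_bind]
        refine (wp_visit_child ih (by exact hc) (by exact hm) (by exact hdep) hp hl
          (by omega)).mono ?_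
        rintro _ s₂ ⟨g₂, d₂, r₂, q₂⟩
        rw [← bind_assoc, wp_bind]
        refine (wp_visit_child ih (by rw [g₂.nodes]; exact hc) (by rw [g₂.nodeCount]; exact hm)
          d₂ hp hr' (by omega)).mono ?_
        rintro _ s₃ ⟨g₃, d₃, r₃, q₃⟩
        exact finish s₃ (g₂.trans g₃) d₃ (by omega) (by omega)
      cases a with
      | empty => exact finish s₁ (.refl _) (by exact hdep) (by omega) (by omega)
      | eps t => exact finish s₁ (.refl _) (by exact hdep) (by omega) (by omega)
      | token t => exact finish s₁ (.refl _) (by exact hdep) (by omega) (by omega)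
      | alt l r => exact two l r (hch l (by simp [Form.children])) (hch r (by simp [Form.children]))
      | seq l r => exact two l r (hch l (by simp [Form.children])) (hch r (by simp [Form.children]))
      | red l f =>
        simp only
        rw [← bind_assoc, wp_bind]
        refine (wp_visit_child ih (by exact hc) (by exact hm) (by exact hdep) hp
          (hch l (by simp [Form.children])) (by omega)).mono ?_
        rintro _ s₂ ⟨g₂, d₂, r₂, q₂⟩
        exact finish s₂ g₂ d₂ (by omega) (by omega)

theorem wp_nullable {m : ℕ} (k : ℕ) (p : ℕ) (s : Store α T) (hc : ClosedBelow m s.nodes)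
    (hm : m ≤ s.nodeCount) (hdep : DependentsBelow m s) (hp : p < m)
    (hk : nullRank s + 1 < k) :
    Wp (nullable k p) s fun _ s' => NullStep m 4 s s' := by
  simp only [nullable, wp_bind, wp_tick]
  refine (wp_visit k p _ (by exact hc) (by exact hm) (by exact hdep) hp
    (by simpa [nullRank, pendingWeight, unvisitedCount] using hk)).mono ?_
  rintro _ s₁ ⟨g, d, r, q⟩
  rw [wp_getNull]
  refine ⟨⟨g.1, g.2, g.3⟩, d, r, ?_⟩
  simp only [nullPotential, pendingWeight, unvisitedCount] at q ⊢
  omega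

end Fixpoint

/-! ### Cost of extracting the parse forest -/

section Forest

variable {α T : Type}

theorem unparsedCount_setForest {s s' : Store α T} {p q : ℕ} (hp : p < s.nodeCount)
    (hn : s.forestMemo p = none) (h1 : s'.nodeCount = s.nodeCount)
    (h2 : s'.forestMemo = Function.update s.forestMemo p (some q)) :
    unparsedCount s' + 1 = unparsedCount s := by
  have := sum_range_add_eq_of_eq_off hp
    (f := fun p => if (s'.forestMemo p).isSome then 0 else 1)
    (g := fun p => if (s.forestMemo p).isSome then 0 else 1)
    (fun i hi => by simp [h2, hi])
  simp only [unparsedCount, h1]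
  simpa [h2, hn] using this

/-- Memoization again: a hit costs two operations, paid by the caller, and a miss uses up one
unparsed node. That node's 10 covers five operations of setup, two calls and the final write. -/
theorem wp_parseNull (k : ℕ) (p : ℕ) (s : Store α T) (hc : ClosedBelow s.nodeCount s.nodes)
    (hp : p < s.nodeCount) (hk : unparsedCount s < k) :
    Wp (parseNull k p) s fun _ s' =>
      s'.nodeCount = s.nodeCount ∧ s'.nodes = s.nodes ∧ unparsedCount s' ≤ unparsedCount s ∧
        s'.time + 10 * unparsedCount s' ≤ s.time + 10 * unparsedCount s + 2 := by
  induction k generalizing p s with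
  | zero => omega
  | succ k ih =>
    simp only [parseNull, wp_bind, wp_tick, wp_getForest]
    rcases hf : s.forestMemo p with _ | q
    · obtain ⟨a, ha, hch⟩ := hc p hp
      simp only [wp_bind]
      rw [wp_readNode (a := a) (by exact ha)]
      have leaf : ∀ (x : ForestNode T (Option ℕ)),
          Wp (newForest x >>= fun q => setForest p q >>= fun _ => pure q)
            { s with time := s.time + 1 + 1 + 1 } fun _ s' =>
            s'.nodeCount = s.nodeCount ∧ s'.nodes = s.nodes ∧
            unparsedCount s' ≤ unparsedCount s ∧
            s'.time + 10 * unparsedCount s' ≤ s.time + 10 * unparsedCount s + 2 := by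
        intro x
        simp only [wp_bind, wp_newForest, wp_setForest, wp_pure]
        have := unparsedCount_setForest (q := s.forestCount) (s' := { s with
          time := s.time + 1 + 1 + 1 + 1 + 1
          forestCount := s.forestCount + 1
          forest := Function.update s.forest s.forestCount (some x)
          forestMemo := Function.update s.forestMemo p (some s.forestCount) }) hp hf rfl rfl
        refine ⟨trivial, trivial, ?_, ?_⟩ <;> omega
      have child : ∀ (t : ℕ) (s₁ : Store α T) (l : ℕ), l < s.nodeCount →
          s₁.nodeCount = s.nodeCount → s₁.nodes = s.nodes →
          unparsedCount s₁ + 1 ≤ unparsedCount s →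
          s₁.time + 10 * unparsedCount s₁ + 10 ≤ s.time + 10 * unparsedCount s + t →
          Wp (parseNull k l) s₁ fun _ s' => s'.nodeCount = s.nodeCount ∧ s'.nodes = s.nodes ∧
            unparsedCount s' + 1 ≤ unparsedCount s ∧
            s'.time + 10 * unparsedCount s' + 10 ≤ s.time + 10 * unparsedCount s + (t + 2) := by
        intro t s₁ l hl h1 h2 h3 h4
        refine (ih l s₁ (by rw [h1, h2]; exact hc) (by omega) (by omega)).mono ?_
        rintro _ s₂ ⟨h1', h2', h3', h4'⟩
        exact ⟨h1'.trans h1, h2'.trans h2, by omega, by omega⟩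
      have first : ∀ (x : ForestNode T (Option ℕ)) (l : ℕ), l < s.nodeCount →
          Wp (newForest x >>= fun q => setForest p q >>= fun _ => parseNull k l)
            { s with time := s.time + 1 + 1 + 1 } fun _ s' =>
            s'.nodeCount = s.nodeCount ∧ s'.nodes = s.nodes ∧
            unparsedCount s' + 1 ≤ unparsedCount s ∧
            s'.time + 10 * unparsedCount s' + 10 ≤ s.time + 10 * unparsedCount s + (5 + 2) := by
        intro x l hl
        simp only [wp_bind, wp_newForest, wp_setForest]
        have := unparsedCount_setForest (q := s.forestCount) (s' := { s with
          time := s.time + 1 + 1 + 1 + 1 + 1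
          forestCount := s.forestCount + 1
          forest := Function.update s.forest s.forestCount (some x)
          forestMemo := Function.update s.forestMemo p (some s.forestCount) }) hp hf rfl rfl
        refine child 5 _ l hl (by rfl) (by rfl) (by omega) ?_
        simp only at this ⊢
        omega
      have fin : ∀ (q : ℕ) (x : ForestNode T (Option ℕ)) (s₁ : Store α T),
          s₁.nodeCount = s.nodeCount → s₁.nodes = s.nodes →
          unparsedCount s₁ + 1 ≤ unparsedCount s →
          s₁.time + 10 * unparsedCount s₁ + 10 ≤ s.time + 10 * unparsedCount s + 9 →
          Wp (writeForest q x >>= fun _ => pure q) s₁ fun _ s' =>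
            s'.nodeCount = s.nodeCount ∧ s'.nodes = s.nodes ∧
            unparsedCount s' ≤ unparsedCount s ∧
            s'.time + 10 * unparsedCount s' ≤ s.time + 10 * unparsedCount s + 2 := by
        intro q x s₁ h1 h2 h3 h4
        simp only [wp_bind, wp_writeForest, wp_pure]
        refine ⟨h1, h2, ?_, ?_⟩ <;> simp only [unparsedCount] at h3 h4 ⊢ <;> omega
      cases a with
      | empty => exact leaf _
      | eps t => exact leaf _
      | token t => exact leaf _
      | alt l r =>
        have hl := first (.amb none none) l (hch l (by simp [Form.children]))
        simp only [wp_bind, wp_newForest, wp_setForest] at hl ⊢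
        refine hl.mono ?_
        rintro l' s₁ ⟨h1, h2, h3, h4⟩
        refine (child _ s₁ r (hch r (by simp [Form.children])) h1 h2 h3 h4).mono ?_
        rintro r' s₂ ⟨h1, h2, h3, h4⟩
        simpa only [wp_bind] using fin s.forestCount _ s₂ h1 h2 h3 h4
      | seq l r =>
        have hl := first (.pair none none) l (hch l (by simp [Form.children]))
        simp only [wp_bind, wp_newForest, wp_setForest] at hl ⊢
        refine hl.mono ?_
        rintro l' s₁ ⟨h1, h2, h3, h4⟩
        refine (child _ s₁ r (hch r (by simp [Form.children])) h1 h2 h3 h4).mono ?_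
        rintro r' s₂ ⟨h1, h2, h3, h4⟩
        simpa only [wp_bind] using fin s.forestCount _ s₂ h1 h2 h3 h4
      | red l f =>
        have hl := first (.apply f none) l (hch l (by simp [Form.children]))
        simp only [wp_bind, wp_newForest, wp_setForest] at hl ⊢
        refine hl.mono ?_
        rintro l' s₁ ⟨h1, h2, h3, h4⟩
        simpa only [wp_bind] using fin s.forestCount _ s₁ h1 h2 h3 (by omega)
    · simp only [wp_pure]
      refine ⟨trivial, trivial, le_rfl, ?_⟩
      simp only [unparsedCount]
      omega

end Forest

/-! ### Names of nodes

Every node that the parser creates descends from a node `base` of the grammar by derivation. The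
derivatives of a sequence node are again a sequence node, named by the word `left` that its left
component has been derived by, or an alternative that was split off this sequence node, and has
been derived by the further word `right`. All other derivatives have an empty `right`. -/

/-- The name of a node: the node of the grammar from which it descends, and the word by which
it was derived, cut at the place where it was split off a sequence node. -/
@[ext]
structure Name (α : Type) where
  base : ℕ
  left : List α
  right : List α

section Names

variable {α T : Type}

/-- The word by which the node of the grammar was derived. -/
def Name.word (n : Name α) : List α := n.left ++ n.right

/-- The possible names of the nodes created for the derivative by `c` of a node named `n`. -/
def Name.IsDeriv (n : Name α) (c : α) (n' : Name α) : Prop :=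
  n.right = [] ∧ n' = ⟨n.base, n.left ++ [c], []⟩ ∨ n' = ⟨n.base, n.left, n.right ++ [c]⟩

theorem Name.IsDeriv.word_eq {n n' : Name α} {c : α} (h : n.IsDeriv c n') :
    n'.word = n.word ++ [c] := by
  rcases h with ⟨h, rfl⟩ | rfl <;> simp [Name.word, *]

theorem Name.IsDeriv.base_eq {n n' : Name α} {c : α} (h : n.IsDeriv c n') :
    n'.base = n.base := by
  rcases h with ⟨-, rfl⟩ | rfl <;> rfl

/-- The origin is recovered by removing the last letter of `right`, or of `left` if `right` is
empty. -/
theorem Name.IsDeriv.unique {n₁ n₂ n' : Name α} {c₁ c₂ : α} (h₁ : n₁.IsDeriv c₁ n')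
    (h₂ : n₂.IsDeriv c₂ n') : n₁ = n₂ ∧ c₁ = c₂ := by
  obtain ⟨b₁, l₁, r₁⟩ := n₁
  obtain ⟨b₂, l₂, r₂⟩ := n₂
  rcases h₁ with ⟨h₁, rfl⟩ | rfl <;> rcases h₂ with ⟨h₂, h⟩ | h <;>
    simp_all [Name.mk.injEq]

/-- The name of the derivative by `c` of a node named `n`, unless it splits. -/
def Name.step (n : Name α) (c : α) : Name α :=
  if n.right = [] then ⟨n.base, n.left ++ [c], []⟩ else ⟨n.base, n.left, n.right ++ [c]⟩

theorem Name.isDeriv_step (n : Name α) (c : α) : n.IsDeriv c (n.step c) := by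
  by_cases h : n.right = []
  · exact .inl ⟨h, by simp [Name.step, h]⟩
  · exact .inr (by simp [Name.step, h])

/-- The names of the nodes of a store are distinct, and consist of a node of the grammar and
a factor of `W`; they are consistent with the memoized derivatives. -/
structure Named (G : ℕ) (W : List α) (name : ℕ → Name α) (s : Store α T) : Prop where
  size_le : G ≤ s.nodeCount
  inj : ∀ p q, p < s.nodeCount → q < s.nodeCount → name p = name q → p = q
  name_of_lt : ∀ p < G, name p = ⟨p, [], []⟩
  base_lt : ∀ p < s.nodeCount, (name p).base < G
  isInfix : ∀ p < s.nodeCount, (name p).word <:+: W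
  origin : ∀ q < s.nodeCount, G ≤ q →
    ∃ p c, p < s.nodeCount ∧ (name p).IsDeriv c (name q) ∧ s.deriveMemo p c ≠ none
  memo : ∀ (p : ℕ) c (q : ℕ), s.deriveMemo p c = some q →
    p < s.nodeCount ∧ q < s.nodeCount ∧ (name q).word = (name p).word ++ [c]

/-- A node of the grammar has the empty word, which no derivative has. Any other bearer of the name
would, by uniqueness of origin, come from this same pair `p`, `c`, whose memo entry is still empty.
-/
theorem Named.fresh {G : ℕ} {W : List α} {name : ℕ → Name α} {s : Store α T}
    (h : Named G W name s) {p : ℕ} {c : α} {n : Name α} (hp : p < s.nodeCount)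
    (hm : s.deriveMemo p c = none) (hn : (name p).IsDeriv c n) :
    ∀ q < s.nodeCount, name q ≠ n := by
  rintro q hq rfl
  rcases lt_or_ge q G with hG | hG
  · have := hn.word_eq
    rw [h.name_of_lt q hG] at this
    simp [Name.word] at this
  · obtain ⟨p', c', hp', hd, hm'⟩ := h.origin q hq hG
    obtain ⟨h1, rfl⟩ := hd.unique hn
    obtain rfl := h.inj _ _ hp' hp h1
    exact hm' hm

/-- The memo table may gain the entry for the new node or stay as it was; the latter serves the
second node made for a nullable sequence, which shares the entry of the first. Freshness is a
hypothesis because by then that entry is filled. -/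
theorem Named.add {G : ℕ} {W : List α} {name : ℕ → Name α} {s s' : Store α T}
    (h : Named G W name s) {p : ℕ} {c : α} {n : Name α} (hp : p < s.nodeCount)
    (hn : (name p).IsDeriv c n) (hf : ∀ q < s.nodeCount, name q ≠ n) (hW : n.word <:+: W)
    (hc : s'.nodeCount = s.nodeCount + 1)
    (hm : ∀ p c, s.deriveMemo p c ≠ none → s'.deriveMemo p c ≠ none)
    (hm' : ∀ p' c' q', s'.deriveMemo p' c' = some q' →
      s.deriveMemo p' c' = some q' ∨ p' = p ∧ c' = c ∧ q' = s.nodeCount)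
    (hpc : s'.deriveMemo p c ≠ none) :
    Named G W (Function.update name s.nodeCount n) s' := by
  have old : ∀ q < s.nodeCount, Function.update name s.nodeCount n q = name q :=
    fun q hq => Function.update_of_ne hq.ne _ _
  have new : Function.update name s.nodeCount n s.nodeCount = n := Function.update_self ..
  have split : ∀ q < s'.nodeCount, q < s.nodeCount ∨ q = s.nodeCount := fun q hq => by omega
  refine ⟨by have := h.size_le; omega, ?_, ?_, ?_, ?_, ?_, ?_⟩
  · intro p q hp hq he
    rcases split p hp with h1 | rfl <;> rcases split q hq with h2 | rfl
    · rw [old p h1, old q h2] at he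
      exact h.inj p q h1 h2 he
    · rw [old p h1, new] at he
      exact absurd he (hf p h1)
    · rw [old q h2, new] at he
      exact absurd he.symm (hf q h2)
    · rfl
  · intro q hq
    rw [old q (hq.trans_le h.size_le), h.name_of_lt q hq]
  · intro q hq
    rcases split q hq with h1 | rfl
    · rw [old q h1]; exact h.base_lt q h1
    · rw [new, hn.base_eq]; exact h.base_lt p hp
  · intro q hq
    rcases split q hq with h1 | rfl
    · rw [old q h1]; exact h.isInfix q h1
    · rw [new]; exact hW
  · intro q hq hG
    rcases split q hq with h1 | rfl
    · obtain ⟨p', c', h2, h3, h4⟩ := h.origin q h1 hG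
      exact ⟨p', c', by omega, by rwa [old p' h2, old q h1], hm _ _ h4⟩
    · exact ⟨p, c, by omega, by rwa [old p hp, new], hpc⟩
  · intro p' c' q' he
    rcases hm' p' c' q' he with h1 | ⟨rfl, rfl, rfl⟩
    · obtain ⟨h2, h3, h4⟩ := h.memo p' c' q' h1
      exact ⟨by omega, by omega, by rwa [old p' h2, old q' h3]⟩
    · exact ⟨by omega, by omega, by rw [new, old p' hp, hn.word_eq]⟩

theorem Named.congr {G : ℕ} {W : List α} {name : ℕ → Name α} {s s' : Store α T}
    (h : Named G W name s) (hc : s'.nodeCount = s.nodeCount)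
    (hm : s'.deriveMemo = s.deriveMemo) : Named G W name s' := by
  obtain ⟨h1, h2, h3, h4, h5, h6, h7⟩ := h
  constructor <;> simpa only [hc, hm]

/-- The node `p` with contents `o` is complete; its children are below `m`, and are named by
suffixes of its own word; the right child of a sequence node belongs to the grammar. -/
def GoodNode (G : ℕ) (name : ℕ → Name α) (m p : ℕ) (o : Option (Form α T (Option ℕ))) : Prop :=
  ∃ a, o.bind Form.complete? = some a ∧
    (∀ l ∈ a.children, l < m ∧ (name l).word <:+ (name p).word) ∧
    ∀ l r, a = .seq l r → r < G ∧ (name p).right = []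

theorem GoodNode.mono {G m m' p : ℕ} {name name' : ℕ → Name α}
    {o : Option (Form α T (Option ℕ))} (h : GoodNode G name m p o) (hp : p < m) (hm : m ≤ m')
    (hn : ∀ i < m, name' i = name i) : GoodNode G name' m' p o := by
  obtain ⟨a, h1, h2, h3⟩ := h
  refine ⟨a, h1, fun l hl => ?_, fun l r he => ?_⟩
  · obtain ⟨h4, h5⟩ := h2 l hl
    exact ⟨by omega, by rwa [hn l h4, hn p hp]⟩
  · rw [hn p hp]; exact h3 l r he

theorem ClosedBelow.of_goodNode {G m : ℕ} {name : ℕ → Name α}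
    {nodes : ℕ → Option (Form α T (Option ℕ))}
    (h : ∀ p < m, GoodNode G name m p (nodes p)) : ClosedBelow m nodes := by
  intro p hp
  obtain ⟨a, h1, h2, -⟩ := h p hp
  exact ⟨a, h1, fun l hl => (h2 l hl).1⟩

end Names

/-! ### Derivatives -/

section Derive

variable {α T : Type}

/-- A stage of the computation of derivatives by `c` of nodes below `m`, that began in the store
`s` and has reached the store `s'`: the nodes in `pend` are still incomplete, the bound on the
depth of nested calls has dropped by `d`, and `t` operations (with an offset of 40) are not
covered by the grant of 60 operations for each new node. -/
structure DeriveStep (G : ℕ) (W : List α) (m : ℕ) (c : α) (pend : Set ℕ) (d t : ℕ)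
    (name : ℕ → Name α) (s : Store α T) (name' : ℕ → Name α) (s' : Store α T) : Prop where
  named : Named G W name' s'
  le : s.nodeCount ≤ s'.nodeCount
  agree : ∀ i < s.nodeCount, name' i = name i
  nodes : ∀ i < s.nodeCount, s'.nodes i = s.nodes i
  good : ∀ i, s.nodeCount ≤ i → i < s'.nodeCount → i ∉ pend →
    GoodNode G name' s'.nodeCount i (s'.nodes i)
  dep : DependentsBelow m s'
  rank : 9 * underivedCount m c s' + nullRank s' + d ≤ 9 * underivedCount m c s + nullRank s
  rank_le : nullRank s' + 4 * s.nodeCount ≤ nullRank s + 4 * s'.nodeCount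
  potential : nullPotential s' + 60 * s.nodeCount + 40 ≤
    nullPotential s + 60 * s'.nodeCount + t

variable {G : ℕ} {W : List α} {m : ℕ} {c : α} {pend : Set ℕ} {d t : ℕ}
  {name name' : ℕ → Name α} {s s' : Store α T}

theorem DeriveStep.weaken (h : DeriveStep G W m c pend d t name s name' s') {d' t' : ℕ}
    (hd : d' ≤ d) (ht : t ≤ t') : DeriveStep G W m c pend d' t' name s name' s' :=
  ⟨h.1, h.2, h.3, h.4, h.5, h.6, by have := h.7; omega, h.8, by have := h.9; omega⟩

theorem DeriveStep.fill (h : DeriveStep G W m c pend d t name s name' s') {q : ℕ}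
    (hq : GoodNode G name' s'.nodeCount q (s'.nodes q)) :
    DeriveStep G W m c (pend \ {q}) d t name s name' s' := by
  refine ⟨h.1, h.2, h.3, h.4, fun i h1 h2 h3 => ?_, h.6, h.7, h.8, h.9⟩
  by_cases hi : i = q
  · rwa [hi]
  · exact h.5 i h1 h2 fun h4 => h3 ⟨h4, hi⟩

theorem DeriveStep.write (h : DeriveStep G W m c pend d t name s name' s') {q : ℕ}
    (hq : s.nodeCount ≤ q) {a : Form α T (Option ℕ)}
    (ha : GoodNode G name' s'.nodeCount q (some a)) :
    DeriveStep G W m c (pend \ {q}) d (t + 1) name s name'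
      { s' with time := s'.time + 1, nodes := Function.update s'.nodes q (some a) } := by
  refine ⟨h.1.congr rfl rfl, h.2, h.3, fun i hi => ?_, fun i h1 h2 h3 => ?_, h.6, h.7, h.8, ?_⟩
  · simp only
    rw [Function.update_of_ne (hi.trans_le hq).ne]
    exact h.4 i hi
  · by_cases hi : i = q
    · subst hi
      simpa using ha
    · simp only
      rw [Function.update_of_ne hi]
      exact h.5 i h1 h2 fun h4 => h3 ⟨h4, hi⟩
  · have := h.9
    simp only [nullPotential, pendingWeight, unvisitedCount] at this ⊢
    omega

/-- The offset 40 lets the natural number `t` express a surplus: 42 means that the caller owes two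
operations, a smaller `t` than 40 that part of the grant is left. -/
theorem DeriveStep.trans (h : DeriveStep G W m c pend d t name s name' s') {name'' : ℕ → Name α}
    {s'' : Store α T} (h' : DeriveStep G W m c ∅ 0 42 name' s' name'' s'') :
    DeriveStep G W m c pend d (t + 2) name s name'' s'' := by
  refine ⟨h'.1, h.2.trans h'.2, fun i hi => ?_, fun i hi => ?_, fun i h1 h2 h3 => ?_, h'.6,
    by have := h.7; have := h'.7; omega, by have := h.8; have := h'.8; omega,
    by have := h.9; have := h'.9; omega⟩
  · rw [h'.3 i (hi.trans_le h.2), h.3 i hi]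
  · rw [h'.4 i (hi.trans_le h.2), h.4 i hi]
  · rcases lt_or_ge i s'.nodeCount with hi | hi
    · rw [h'.4 i hi]
      exact (h.5 i h1 hi h3).mono hi h'.2 h'.3
    · exact h'.5 i hi h2 (by simp)

/-- Dependencies lie below `m`, so a fresh address has none. -/
theorem pendingWeight_newNode (hdep : DependentsBelow m s) (hm : m ≤ s.nodeCount)
    (h1 : s'.nodeCount = s.nodeCount + 1) (h2 : s'.isNull = s.isNull)
    (h3 : s'.dependents = s.dependents) : pendingWeight s' ≤ pendingWeight s + 1 := by
  have : s.dependents s.nodeCount = [] := by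
    rw [List.eq_nil_iff_forall_not_mem]
    intro e he
    exact hm.not_gt (hdep _ e he).1
  simp only [pendingWeight, h1, h2, h3, Finset.sum_range_succ, this]
  split <;> simp

theorem unvisitedCount_newNode (h1 : s'.nodeCount = s.nodeCount + 1)
    (h2 : s'.visited = s.visited) : unvisitedCount s' ≤ unvisitedCount s + 1 := by
  simp only [unvisitedCount, h1, h2, Finset.sum_range_succ]
  split <;> simp

theorem underivedCount_setDerive [DecidableEq α] {p q : ℕ} (hp : p < m)
    (hn : s.deriveMemo p c = none)
    (h : s'.deriveMemo =
      Function.update s.deriveMemo p (Function.update (s.deriveMemo p) c (some q))) :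
    underivedCount m c s' + 1 = underivedCount m c s := by
  have := sum_range_add_eq_of_eq_off hp
    (f := fun p => if (s'.deriveMemo p c).isSome then 0 else 1)
    (g := fun p => if (s.deriveMemo p c).isSome then 0 else 1)
    (fun i hi => by simp [h, hi])
  simp only [underivedCount]
  simpa [h, hn] using this

/-- The creation of the node for a derivative, after at most seven operations. -/
theorem DeriveStep.alloc [DecidableEq α] (hN : Named G W name s) (hm : m ≤ s.nodeCount) {p : ℕ}
    (hp : p < m) (hnone : s.deriveMemo p c = none) (h : NullStep m 7 s s') {n : Name α}
    (hn : (name p).IsDeriv c n) (hW : n.word <:+: W) (a : Form α T (Option ℕ)) :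
    DeriveStep G W m c {s'.nodeCount} 5 32 name s (Function.update name s'.nodeCount n)
      { s' with
        time := s'.time + 1 + 1
        nodeCount := s'.nodeCount + 1
        nodes := Function.update s'.nodes s'.nodeCount (some a)
        deriveMemo := Function.update s'.deriveMemo p
          (Function.update (s'.deriveMemo p) c (some s'.nodeCount)) } := by
  set s₁ : Store α T := { s' with
    time := s'.time + 1 + 1
    nodeCount := s'.nodeCount + 1
    nodes := Function.update s'.nodes s'.nodeCount (some a)
    deriveMemo := Function.update s'.deriveMemo p
      (Function.update (s'.deriveMemo p) c (some s'.nodeCount)) } with hs₁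
  have hc₁ : s₁.nodeCount = s'.nodeCount + 1 := rfl
  have hc := h.nodeCount
  have hD : underivedCount m c s₁ + 1 = underivedCount m c s' :=
    underivedCount_setDerive hp (by rw [h.deriveMemo]; exact hnone) rfl
  have hD' : underivedCount m c s' = underivedCount m c s := by
    unfold underivedCount; rw [h.deriveMemo]
  have hw : pendingWeight s₁ ≤ pendingWeight s' + 1 :=
    pendingWeight_newNode h.dep (by omega) rfl rfl rfl
  have hu : unvisitedCount s₁ ≤ unvisitedCount s' + 1 := unvisitedCount_newNode rfl rfl
  have hr := h.rank
  have hq := h.potential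
  have ht : s₁.time = s'.time + 1 + 1 := rfl
  have hN' : Named G W name s' := hN.congr h.nodeCount h.deriveMemo
  have hp' : p < s'.nodeCount := by omega
  have hnone' : s'.deriveMemo p c = none := by rw [h.deriveMemo]; exact hnone
  have memo₁ : ∀ p' c', ¬ (p' = p ∧ c' = c) → s₁.deriveMemo p' c' = s'.deriveMemo p' c' := by
    intro p' c' hne
    simp only [hs₁]
    by_cases hpp : p' = p
    · subst hpp
      rw [Function.update_self, Function.update_of_ne fun h => hne ⟨rfl, h⟩]
    · rw [Function.update_of_ne hpp]
  have memo₂ : s₁.deriveMemo p c = some s'.nodeCount := by simp [hs₁]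
  refine ⟨hN'.add hp' hn (hN'.fresh hp' hnone' hn) hW rfl ?_ ?_ (by simp [memo₂]), by omega,
    fun i hi => Function.update_of_ne (by omega) _ _, fun i hi => ?_, fun i h1 h2 h3 => ?_,
    h.dep, ?_, ?_, ?_⟩
  · intro p' c' hne
    by_cases hpc : p' = p ∧ c' = c
    · obtain ⟨rfl, rfl⟩ := hpc
      simp [memo₂]
    · rwa [memo₁ p' c' hpc]
  · intro p' c' q' he
    by_cases hpc : p' = p ∧ c' = c
    · obtain ⟨rfl, rfl⟩ := hpc
      rw [memo₂] at he
      exact .inr ⟨rfl, rfl, (Option.some.inj he).symm⟩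
    · rw [memo₁ p' c' hpc] at he
      exact .inl he
  · simp only [hs₁]
    rw [Function.update_of_ne (show i < s'.nodeCount by omega).ne, h.nodes]
  · simp only [Set.mem_singleton_iff] at h3
    omega
  -- A new node raises `nullRank` by at most 1 + 3 = 4 and the memo entry lowers the other term by
  -- 9, so the depth bound drops by 5, and still by 1 after a second node.
  · unfold nullRank at *; omega
  · unfold nullRank at *; omega
  · unfold nullPotential at *; omega

/-- The creation of the second node for the derivative of a sequence node. -/
theorem DeriveStep.alloc_second {p : ℕ}
    (h : DeriveStep G W m c pend 5 32 name s name' s') (hm : m ≤ s.nodeCount) (hp : p < m)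
    (hpc : s'.deriveMemo p c ≠ none)
    {n : Name α} (hn : (name p).IsDeriv c n) (hf : ∀ q < s'.nodeCount, name' q ≠ n)
    (hW : n.word <:+: W) (a : Form α T (Option ℕ)) :
    DeriveStep G W m c (insert s'.nodeCount pend) 1 30 name s
      (Function.update name' s'.nodeCount n)
      { s' with
        time := s'.time + 1
        nodeCount := s'.nodeCount + 1
        nodes := Function.update s'.nodes s'.nodeCount (some a) } := by
  have hle := h.le
  set s₁ : Store α T := { s' with
    time := s'.time + 1
    nodeCount := s'.nodeCount + 1
    nodes := Function.update s'.nodes s'.nodeCount (some a) } with hs₁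
  have hc₁ : s₁.nodeCount = s'.nodeCount + 1 := rfl
  have hD : underivedCount m c s₁ = underivedCount m c s' := rfl
  have hw : pendingWeight s₁ ≤ pendingWeight s' + 1 :=
    pendingWeight_newNode h.dep (by omega) rfl rfl rfl
  have hu : unvisitedCount s₁ ≤ unvisitedCount s' + 1 := unvisitedCount_newNode rfl rfl
  have ht : s₁.time = s'.time + 1 := rfl
  have hr := h.rank
  have hr' := h.rank_le
  have hq := h.potential
  refine ⟨h.named.add (p := p) (c := c) (by omega) (by rwa [h.agree p (by omega)]) hf hW rfl
    (fun _ _ h => h) (fun _ _ _ h => .inl h) hpc, by omega, fun i hi => ?_, fun i hi => ?_,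
    fun i h1 h2 h3 => ?_, h.dep, ?_, ?_, ?_⟩
  · rw [Function.update_of_ne (by omega), h.agree i hi]
  · simp only [hs₁]
    rw [Function.update_of_ne (show i < s'.nodeCount by omega).ne, h.nodes i hi]
  · simp only [Set.mem_insert_iff, not_or] at h3
    simp only [hs₁]
    rw [Function.update_of_ne h3.1]
    exact (h.good i h1 (by omega) h3.2).mono (by omega) (by omega)
      fun j hj => Function.update_of_ne hj.ne _ _
  · unfold nullRank at *; omega
  · unfold nullRank at *; omega
  · unfold nullPotential at *; omega

end Derive

/-! ### Correctness of names and cost of one derivation -/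

section DeriveSpec

variable {α T : Type} {G : ℕ} {W : List α} {m : ℕ} {c : α}

/-- The derivation by `c`, begun in the store `s`, of a node whose name has the word `u` has ended
in the store `s'`, with the node at the address `q` as its result. -/
def Derived (G : ℕ) (W : List α) (m : ℕ) (c : α) (name : ℕ → Name α) (s : Store α T)
    (u : List α) (q : ℕ) (s' : Store α T) : Prop :=
  ∃ name', DeriveStep G W m c ∅ 0 42 name s name' s' ∧ q < s'.nodeCount ∧
    (name' q).word = u ++ [c]

theorem suffix_append_right {u v : List α} (h : u <:+ v) (w : List α) : u ++ w <:+ v ++ w := by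
  obtain ⟨x, rfl⟩ := h
  exact ⟨x, by simp⟩

/-- Here `m` stays fixed through the recursion while the store grows: recursive calls go to children
of old nodes, which are below `m`. The suffix condition on `u` passes to children and keeps all new
words factors of `W`. -/
theorem wp_derive [DecidableEq α] (tok : α → T) {u : List α} (hu : u ++ [c] <:+: W) (k : ℕ)
    (p : ℕ) (s : Store α T) (name : ℕ → Name α) (hN : Named G W name s) (hm : m ≤ s.nodeCount)
    (hgood : ∀ i < m, GoodNode G name m i (s.nodes i)) (hdep : DependentsBelow m s)
    (hp : p < m) (hpu : (name p).word <:+ u)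
    (hk : 9 * underivedCount m c s + nullRank s + 1 < k) :
    Wp (derive tok k p c) s fun q s' =>
      Derived G W m c name s (name p).word q s' := by
  induction k generalizing p s name with
  | zero => omega
  | succ k ih =>
    simp only [derive, wp_bind, wp_tick, wp_getDerive]
    rcases hf : s.deriveMemo p c with _ | q
    swap
    · simp only [wp_pure]
      obtain ⟨-, h1, h2⟩ := hN.memo p c q hf
      refine ⟨name, ⟨hN.congr rfl rfl, le_rfl, fun _ _ => rfl, fun _ _ => rfl,
        fun i h3 h4 => absurd h3 h4.not_ge, hdep, le_rfl, le_rfl, ?_⟩, h1, h2⟩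
      simp only [nullPotential, pendingWeight, unvisitedCount]
      omega
    -- Since `p` itself is not derived yet, the depth bound leaves room for the nullability call.
    have hD : 1 ≤ underivedCount m c s := by
      have := underivedCount_setDerive (s := s) (s' := { s with
        deriveMemo := Function.update s.deriveMemo p
          (Function.update (s.deriveMemo p) c (some 0)) }) hp hf rfl
      omega
    obtain ⟨a, ha, hch, hseq⟩ := hgood p hp
    simp only [wp_bind]
    rw [wp_readNode (a := a) (by exact ha)]
    have hpW : ∀ n, (name p).IsDeriv c n → n.word <:+: W := by
      intro n hn
      rw [hn.word_eq]
      obtain ⟨v, rfl⟩ := hpu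
      exact (List.IsSuffix.isInfix ⟨v, by simp⟩).trans hu
    have hstep := (name p).isDeriv_step c
    -- Seven is the longest preamble before a node is created: call, memo lookup and read, then four
    -- operations for nullability.
    have start : ∀ t ≤ 7, NullStep m 7 s { s with time := s.time + t } := by
      intro t ht
      refine ⟨⟨rfl, rfl, rfl⟩, hdep, le_rfl, ?_⟩
      simp only [nullPotential, pendingWeight, unvisitedCount]
      omega
    have call : ∀ (pend : Set ℕ) (d t : ℕ) (l : ℕ) (s₁ : Store α T) (name₁ : ℕ → Name α),
        l < m → (name l).word <:+ (name p).word → 1 ≤ d →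
        DeriveStep G W m c pend d t name s name₁ s₁ →
        Wp (derive tok k l c) s₁ fun l' s₂ => ∃ name₂,
          DeriveStep G W m c pend d (t + 2) name s name₂ s₂ ∧ l' < s₂.nodeCount ∧
          (name₂ l').word = (name l).word ++ [c] ∧ s₁.nodeCount ≤ s₂.nodeCount ∧
          ∀ i < s₁.nodeCount, name₂ i = name₁ i := by
      intro pend d t l s₁ name₁ hl hlp hd h
      have hle := h.le
      have hr := h.rank
      have heq : name₁ l = name l := h.agree l (by omega)
      refine (ih l s₁ name₁ h.named (by omega) (fun i hi => ?_) h.dep hl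
        (by rw [heq]; exact hlp.trans hpu) (by omega)).mono ?_
      · rw [h.nodes i (by omega)]
        exact (hgood i hi).mono hi le_rfl fun j hj => h.agree j (by omega)
      · rintro l' s₂ ⟨name₂, h1, h2, h3⟩
        exact ⟨name₂, h.trans h1, h2, by rw [h3, heq], h1.le, h1.agree⟩
    have leaf : ∀ (t : ℕ) (x : Form α T (Option ℕ)) (y : Form α T ℕ), t ≤ 7 →
        x.complete? = some y → y.children = [] →
        Wp (newNode x >>= fun q => setDerive p c q >>= fun _ => pure q)
          { s with time := s.time + t } fun q s' =>
          Derived G W m c name s (name p).word q s' := by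
      intro t x y ht hx hy
      simp only [wp_bind, wp_newNode, wp_setDerive, wp_pure]
      have h := DeriveStep.alloc hN hm hp hf (start t ht) hstep (hpW _ hstep) x
      have h' := (h.fill (q := s.nodeCount) ⟨y, by simpa using hx, by simp [hy],
        by rintro l r rfl; simp [Form.children] at hy⟩).weaken (Nat.zero_le 5)
          (show 32 ≤ 42 by omega)
      simp only [sdiff_self, Set.bot_eq_empty] at h'
      exact ⟨_, h', Nat.lt_succ_self _, by simpa using hstep.word_eq⟩
    cases a with
    | empty => exact leaf 3 _ .empty (by omega) rfl rfl
    | eps x => exact leaf 3 _ .empty (by omega) rfl rfl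
    | token c' =>
      simp only [wp_bind, wp_sameToken]
      by_cases hcc : c = c'
      · have := leaf 4 (.eps (tok c)) _ (by omega) rfl rfl
        simpa only [wp_bind, hcc, decide_true, if_true] using this
      · have := leaf 4 .empty _ (by omega) rfl rfl
        simpa only [wp_bind, hcc, decide_false, Bool.false_eq_true, if_false] using this
    | alt l r =>
      obtain ⟨hl, hlp⟩ := hch l (by simp [Form.children])
      obtain ⟨hr, hrp⟩ := hch r (by simp [Form.children])
      simp only [wp_bind, wp_newNode, wp_setDerive]
      have h := DeriveStep.alloc hN hm hp hf (start 3 (by omega)) hstep (hpW _ hstep)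
        (.alt none none)
      refine (call _ _ _ l _ _ hl hlp (by omega) h).mono ?_
      rintro l' s₂ ⟨name₂, h₂, hl₂, hlw, hle₂, hag₂⟩
      refine (call _ _ _ r _ _ hr hrp (by omega) h₂).mono ?_
      rintro r' s₃ ⟨name₃, h₃, hr₃, hrw, hle₃, hag₃⟩
      simp only [wp_writeNode, wp_pure]
      simp only at hle₂ hag₂
      have hq : (name₃ s.nodeCount).word = (name p).word ++ [c] := by
        rw [hag₃ _ (by omega), hag₂ _ (by omega)]
        simpa using hstep.word_eq
      have h₄ := (h₃.write (q := s.nodeCount) le_rfl (a := .alt (some l') (some r'))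
        ⟨.alt l' r', rfl, by
          simp only [Form.children, List.mem_cons, List.not_mem_nil, or_false, forall_eq_or_imp,
            forall_eq, hq, hrw, hag₃ _ hl₂, hlw]
          exact ⟨⟨hl₂.trans_le hle₃, suffix_append_right hlp [c]⟩, ⟨hr₃, suffix_append_right hrp [c]⟩⟩,
          by rintro _ _ ⟨⟩⟩).weaken (Nat.zero_le _) (show _ ≤ 42 by omega)
      simp only [sdiff_self, Set.bot_eq_empty] at h₄
      exact ⟨_, h₄, by simp only; omega, hq⟩
    | red l f =>
      obtain ⟨hl, hlp⟩ := hch l (by simp [Form.children])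
      simp only [wp_bind, wp_newNode, wp_setDerive]
      have h := DeriveStep.alloc hN hm hp hf (start 3 (by omega)) hstep (hpW _ hstep)
        (.red none f)
      refine (call _ _ _ l _ _ hl hlp (by omega) h).mono ?_
      rintro l' s₂ ⟨name₂, h₂, hl₂, hlw, hle₂, hag₂⟩
      simp only [wp_writeNode, wp_pure]
      simp only at hle₂ hag₂
      have hq : (name₂ s.nodeCount).word = (name p).word ++ [c] := by
        rw [hag₂ _ (by omega)]
        simpa using hstep.word_eq
      have h₄ := (h₂.write (q := s.nodeCount) le_rfl (a := .red (some l') f)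
        ⟨.red l' f, rfl, by
          simp only [Form.children, List.mem_cons, List.not_mem_nil, or_false,
            forall_eq, hq, hlw]
          exact ⟨by omega, suffix_append_right hlp [c]⟩,
          by rintro _ _ ⟨⟩⟩).weaken (Nat.zero_le _) (show _ ≤ 42 by omega)
      simp only [sdiff_self, Set.bot_eq_empty] at h₄
      exact ⟨_, h₄, by simp only; omega, hq⟩
    | seq l r =>
      obtain ⟨hl, hlp⟩ := hch l (by simp [Form.children])
      obtain ⟨hr, hrp⟩ := hch r (by simp [Form.children])
      obtain ⟨hrG, hright⟩ := hseq l r rfl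
      simp only [wp_bind]
      refine (wp_nullable (m := m) k l _ (.of_goodNode (by exact hgood)) (by exact hm)
        (by exact hdep) hl
        (by simp only [nullRank, pendingWeight, unvisitedCount] at hk ⊢; omega)).mono ?_
      intro null s₀ h₀
      have hns : NullStep m 7 s s₀ := by
        refine ⟨⟨h₀.nodeCount, h₀.nodes, h₀.deriveMemo⟩, h₀.dep, h₀.rank, ?_⟩
        have := h₀.potential
        simp only [nullPotential, pendingWeight, unvisitedCount] at this ⊢
        omega
      have hc₀ : s₀.nodeCount = s.nodeCount := h₀.nodeCount
      have hrW : (name r).word = [] := by rw [hN.name_of_lt r hrG]; rfl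
      cases null with
      | true =>
        simp only [if_true, wp_bind, wp_newNode, wp_setDerive]
        -- The split: the alternative moves the token to `right`, the sequence inside it keeps
        -- `right` empty and can split again. Only the alternative enters the memo table.
        have hn₁ : (name p).IsDeriv c ⟨(name p).base, (name p).left, (name p).right ++ [c]⟩ :=
          .inr rfl
        have hn₂ : (name p).IsDeriv c ⟨(name p).base, (name p).left ++ [c], []⟩ :=
          .inl ⟨hright, rfl⟩
        have h₁ := DeriveStep.alloc hN hm hp hf hns hn₁ (hpW _ hn₁) (.alt none none)
        -- The second name is new among the old nodes because the memo entry was empty in `s`, and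
        -- differs from the first because its `right` is empty.
        have h := h₁.alloc_second hm hp (by simp) hn₂ (by
          intro q hq
          simp only at hq
          rcases (Nat.lt_succ_iff_lt_or_eq.1 hq) with hq | rfl
          · rw [Function.update_of_ne hq.ne]
            exact hN.fresh (hp.trans_le hm) hf hn₂ q (by omega)
          · simp) (hpW _ hn₂) (.seq none (some r))
        refine (call _ _ _ l _ _ hl hlp le_rfl h).mono ?_
        rintro l' s₂ ⟨name₂, h₂, hl₂, hlw, hle₂, hag₂⟩
        simp only [wp_writeNode]
        simp only at hle₂ hag₂
        have hq' : name₂ (s₀.nodeCount + 1) =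
            ⟨(name p).base, (name p).left ++ [c], []⟩ := by
          rw [hag₂ _ (by omega)]
          simp
        have hq : name₂ s₀.nodeCount =
            ⟨(name p).base, (name p).left, (name p).right ++ [c]⟩ := by
          rw [hag₂ _ (by omega), Function.update_of_ne (by omega)]
          simp
        have hr₂ : name₂ r = name r := h₂.agree r (by omega)
        have h₃ := h₂.write (q := s₀.nodeCount + 1) (by omega)
          (a := .seq (some l') (some r)) ⟨.seq l' r, rfl, by
            simp only [Form.children, List.mem_cons, List.not_mem_nil, or_false,
              forall_eq_or_imp, forall_eq, hr₂, hrW, hlw, hq', hn₂.word_eq]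
            exact ⟨⟨by omega, suffix_append_right hlp [c]⟩, ⟨by omega, List.nil_suffix⟩⟩, by
            rintro _ _ ⟨⟩
            exact ⟨hrG, by rw [hq']⟩⟩
        refine (call _ _ _ r _ _ hr hrp le_rfl h₃).mono ?_
        rintro r' s₃ ⟨name₃, h₄, hr₃, hrw, hle₃, hag₃⟩
        simp only [wp_pure]
        simp only at hle₃ hag₃
        have hq₃ : (name₃ s₀.nodeCount).word = (name p).word ++ [c] := by
          rw [hag₃ _ (by omega), hq, hn₁.word_eq]
        have hq₃' : (name₃ (s₀.nodeCount + 1)).word = (name p).word ++ [c] := by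
          rw [hag₃ _ (by omega), hq', hn₂.word_eq]
        have h₅ := (h₄.write (q := s₀.nodeCount) (by omega)
          (a := .alt (some (s₀.nodeCount + 1)) (some r')) ⟨.alt (s₀.nodeCount + 1) r', rfl, by
            simp only [Form.children, List.mem_cons, List.not_mem_nil, or_false,
              forall_eq_or_imp, forall_eq, hq₃, hq₃', hrw]
            exact ⟨⟨by omega, List.suffix_rfl⟩, ⟨hr₃, suffix_append_right hrp [c]⟩⟩,
            by rintro _ _ ⟨⟩⟩).weaken (Nat.zero_le _) (show _ ≤ 42 by omega)
        have he : ∀ i j : ℕ, (({i, j} : Set ℕ) \ {i}) \ {j} = ∅ := by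
          intro i j
          ext x
          simp
        rw [he] at h₅
        exact ⟨_, h₅, by simp only; omega, hq₃⟩
      | false =>
        simp only [Bool.false_eq_true, if_false, wp_bind, wp_newNode, wp_setDerive]
        have h := DeriveStep.alloc hN hm hp hf hns hstep (hpW _ hstep) (.seq none (some r))
        refine (call _ _ _ l _ _ hl hlp (by omega) h).mono ?_
        rintro l' s₂ ⟨name₂, h₂, hl₂, hlw, hle₂, hag₂⟩
        simp only [wp_writeNode, wp_pure]
        simp only at hle₂ hag₂
        have hq : name₂ s₀.nodeCount = (name p).step c := by
          rw [hag₂ _ (by omega)]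
          simp
        have hr₂ : name₂ r = name r := h₂.agree r (by omega)
        have h₃ := (h₂.write (q := s₀.nodeCount) (by omega)
          (a := .seq (some l') (some r)) ⟨.seq l' r, rfl, by
            simp only [Form.children, List.mem_cons, List.not_mem_nil, or_false,
              forall_eq_or_imp, forall_eq, hr₂, hrW, hlw, hq, hstep.word_eq]
            exact ⟨⟨by omega, suffix_append_right hlp [c]⟩, ⟨by omega, List.nil_suffix⟩⟩, by
            rintro _ _ ⟨⟩
            exact ⟨hrG, by rw [hq]; simp [Name.step, hright]⟩⟩).weaken (Nat.zero_le _)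
              (show _ ≤ 42 by omega)
        simp only [sdiff_self, Set.bot_eq_empty] at h₃
        exact ⟨_, h₃, by simp only; omega, by rw [hq, hstep.word_eq]⟩

end DeriveSpec

/-! ### Counting names, and the whole run -/

section Parse

variable {α T : Type}

/-- A name is recovered from its base, the position of its word in `W`, and the lengths of the two
pieces. -/
theorem Named.nodeCount_le {G : ℕ} {W : List α} {name : ℕ → Name α} {s : Store α T}
    (h : Named G W name s) : s.nodeCount ≤ G * (W.length + 1) ^ 3 := by
  classical
  let R := Finset.range (W.length + 1)
  let F : ℕ × ℕ × ℕ × ℕ → Name α := fun x =>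
    ⟨x.1, (W.drop x.2.1).take x.2.2.1, (W.drop (x.2.1 + x.2.2.1)).take x.2.2.2⟩
  have hsurj : (Finset.range s.nodeCount).image name ⊆
      (Finset.range G ×ˢ R ×ˢ R ×ˢ R).image F := by
    intro n hn
    obtain ⟨p, hp, rfl⟩ := Finset.mem_image.1 hn
    rw [Finset.mem_range] at hp
    obtain ⟨a, b, hab⟩ := h.isInfix p hp
    have hlen := congrArg List.length hab
    simp only [Name.word, List.length_append] at hlen
    refine Finset.mem_image.2
      ⟨((name p).base, a.length, (name p).left.length, (name p).right.length), ?_, ?_⟩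
    · simp only [Finset.mem_product, Finset.mem_range, R]
      exact ⟨h.base_lt p hp, by omega, by omega, by omega⟩
    · have e₁ : W.drop a.length = (name p).left ++ ((name p).right ++ b) := by
        rw [← hab]; simp [Name.word]
      have e₂ : W.drop (a.length + (name p).left.length) = (name p).right ++ b := by
        rw [← List.drop_drop, e₁]; simp
      ext1 <;> simp [F, e₁, e₂]
  calc s.nodeCount = ((Finset.range s.nodeCount).image name).card := by
        rw [Finset.card_image_of_injOn, Finset.card_range]
        intro p hp q hq he
        exact h.inj p q (by simpa using hp) (by simpa using hq) he
    _ ≤ (Finset.range G ×ˢ R ×ˢ R ×ˢ R).card :=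
        (Finset.card_le_card hsurj).trans Finset.card_image_le
    _ = G * (W.length + 1) ^ 3 := by
        simp only [Finset.card_product, Finset.card_range, R]; ring

theorem underivedCount_le (m : ℕ) (c : α) (s : Store α T) : underivedCount m c s ≤ m := by
  refine (Finset.sum_le_card_nsmul _ _ 1 fun p _ => ?_).trans (by simp)
  split <;> simp

theorem unparsedCount_le (s : Store α T) : unparsedCount s ≤ s.nodeCount := by
  refine (Finset.sum_le_card_nsmul _ _ 1 fun p _ => ?_).trans (by simp)
  split <;> simp

/-- The 70 is 60 per node for derivation and 10 for the forest; each token, and the end of input,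
adds 3 for the loop and the outer call. The depth 13 is 9 per underived node plus the invariant 4
per node for `nullRank`. -/
theorem wp_parseFrom [DecidableEq α] (tok : α → T) {G : ℕ} {W : List α} (k : ℕ)
    (hk : 13 * (G * (W.length + 1) ^ 3) + 1 < k) (w u : List α) (huw : u ++ w = W) (p : ℕ)
    (s : Store α T) (name : ℕ → Name α) (hN : Named G W name s)
    (hgood : ∀ i < s.nodeCount, GoodNode G name s.nodeCount i (s.nodes i))
    (hdep : DependentsBelow s.nodeCount s) (hp : p < s.nodeCount) (hpu : (name p).word <:+ u)
    (hr : nullRank s ≤ 4 * s.nodeCount) :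
    Wp (parseFrom tok k p w) s fun _ s' =>
      s'.time + 60 * s.nodeCount ≤
        nullPotential s + 70 * (G * (W.length + 1) ^ 3) + 3 * w.length + 3 := by
  have hcount := hN.nodeCount_le
  induction w generalizing u p s name with
  | nil =>
    simp only [parseFrom, wp_bind, wp_tick]
    have hle := unparsedCount_le s
    refine (wp_parseNull k p _ (.of_goodNode (by exact hgood)) (by exact hp)
      (by simp only [unparsedCount] at hle ⊢; omega)).mono ?_
    rintro _ s' ⟨-, -, -, h⟩
    simp only [unparsedCount, nullPotential, List.length_nil] at h hle ⊢
    omega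
  | cons c w ih =>
    simp only [parseFrom, wp_bind, wp_tick]
    have hle := underivedCount_le s.nodeCount c s
    refine (wp_derive (m := s.nodeCount) tok (c := c) (u := u) (W := W)
      ⟨[], w, by simp [← huw]⟩ k p { s with time := s.time + 1 } name
      (hN.congr rfl rfl) le_rfl (by exact hgood) (by exact hdep) hp hpu ?_).mono ?_
    · simp only [nullRank, pendingWeight, unvisitedCount, underivedCount] at hr hle ⊢
      omega
    rintro q s₁ ⟨name₁, h, hq, hqw⟩
    have hle₁ : s.nodeCount ≤ s₁.nodeCount := h.le
    have hrank : nullRank s₁ + 4 * s.nodeCount ≤ nullRank s + 4 * s₁.nodeCount := h.rank_le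
    have hpot : nullPotential s₁ + 60 * s.nodeCount + 40 ≤
        nullPotential s + 1 + 60 * s₁.nodeCount + 42 := by
      have := h.potential
      simp only [nullPotential, pendingWeight, unvisitedCount] at this ⊢
      omega
    refine (ih (u ++ [c]) (by simp [← huw]) q s₁ name₁ h.named (fun i hi => ?_)
      (fun d e he => ?_) hq (by rw [hqw]; exact suffix_append_right hpu [c]) (by omega)
      h.named.nodeCount_le).mono ?_
    · rcases lt_or_ge i s.nodeCount with hi' | hi'
      · rw [h.nodes i hi']
        exact (hgood i hi').mono hi' hle₁ h.agree
      · exact h.good i hi' hi (by simp)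
    · obtain ⟨h1, h2⟩ := h.dep d e he
      exact ⟨h1.trans_le hle₁, h2.trans_le hle₁⟩
    · intro _ s₂ h₂
      simp only [List.length_cons]
      omega

theorem Form.complete?_map_some {P Q : Type} (h : P → Q) (a : Form α T P) :
    (a.map fun i => some (h i)).complete? = some (a.map h) := by
  cases a <;> rfl

theorem Grammar.named_initialStore (g : Grammar α T) (W : List α) :
    Named g.size W (fun p => ⟨p, [], []⟩) g.initialStore where
  size_le := le_rfl
  inj _ _ _ _ h := congrArg Name.base h
  name_of_lt _ _ := rfl
  base_lt _ h := h
  isInfix _ _ := ⟨[], W, rfl⟩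
  origin _ h h' := absurd h' h.not_ge
  memo _ _ _ h := by simp [Grammar.initialStore] at h

theorem Grammar.goodNode_initialStore (g : Grammar α T) (p : ℕ) (hp : p < g.size) :
    GoodNode g.size (fun p => ⟨p, [], []⟩) g.size p (g.initialStore.nodes p) := by
  refine ⟨(g.node ⟨p, hp⟩).map Fin.val, ?_, ?_, ?_⟩
  · simp [Grammar.initialStore, hp, Form.complete?_map_some]
  · intro l hl
    refine ⟨?_, List.suffix_rfl⟩
    revert hl
    cases g.node ⟨p, hp⟩ <;> simp [Form.map, Form.children] <;> omega
  · intro l r h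
    refine ⟨?_, rfl⟩
    revert h
    cases g.node ⟨p, hp⟩ <;> simp [Form.map]
    omega

end Parse

end PWD

theorem theorem9 :
    ∃ C : ℕ, ∀ (α T : Type) [DecidableEq α] (tok : α → T) (g : PWD.Grammar α T) (w : List α),
      ∃ (k : ℕ) (forest : PWD.Ptr) (final : PWD.Store α T),
        PWD.parse tok k g w = some (forest, final) ∧
          final.time ≤ C * g.size * (max w.length 1) ^ 3 := by
  -- From `n + 1 ≤ 2 * N` the 70 becomes 560; the linear terms need at most 6 more, and the initial
  -- credit 41 per node is below the 60 already accounted for.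
  refine ⟨600, fun α T _ tok g w => ?_⟩
  set N := max w.length 1 with hN
  set B := g.size * (w.length + 1) ^ 3 with hB
  have hG : 1 ≤ g.size := g.root.pos
  have hc : g.initialStore.nodeCount = g.size := rfl
  have hw : PWD.pendingWeight g.initialStore = g.size := by
    simp [PWD.pendingWeight, PWD.Grammar.initialStore]
  have hu : PWD.unvisitedCount g.initialStore = g.size := by
    simp [PWD.unvisitedCount, PWD.Grammar.initialStore]
  have ht : g.initialStore.time = 0 := rfl
  obtain ⟨forest, final, h, htime⟩ := PWD.wp_parseFrom tok (W := w) (13 * B + 2) (by omega) w []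
    rfl g.root.val g.initialStore _ (g.named_initialStore w) g.goodNode_initialStore
    (by intro p d hd; simp [PWD.Grammar.initialStore] at hd) g.root.isLt List.suffix_rfl
    (by unfold PWD.nullRank; omega)
  refine ⟨_, forest, final, h, ?_⟩
  rw [PWD.nullPotential, hw, hu, ht, hc, ← hB] at htime
  have h1 : 1 ≤ N := le_max_right _ _
  have hNw : w.length ≤ N := le_max_left _ _
  have hBN : B ≤ g.size * (8 * N ^ 3) := by
    refine Nat.mul_le_mul_left _ ?_
    calc (w.length + 1) ^ 3 ≤ (2 * N) ^ 3 := Nat.pow_le_pow_left (by omega) 3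
      _ = 8 * N ^ 3 := by ring
  have hN3 : N ≤ N ^ 3 := Nat.le_self_pow (by norm_num) N
  have hGN : N ^ 3 ≤ g.size * N ^ 3 := Nat.le_mul_of_pos_left _ hG
  have e1 : g.size * (8 * N ^ 3) = 8 * (g.size * N ^ 3) := by ring
  have e2 : 600 * g.size * N ^ 3 = 600 * (g.size * N ^ 3) := by ring
  omega
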